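/- **Zamansky's Theorem, and the solution of von Renteln's Problem 5.62.** For a continuous $2\pi$-periodic (real- or complex-valued) function $f$ on $\mathbb{R}$, and $0<h\le\pi$, $x\in\mathbb{R}$, put $$\tilde f(x,h) = -\frac1\pi\int_h^\pi [f(x+t)-f(x-t)]\,\tfrac12\cot(\tfrac12 t)\,dt ,$$ and let the conjugate function $\tilde f$ be given by $\tilde f(x)=\lim_{h\to0+}\tilde f(x,h)$ for almost every $x$. Since $\tilde f$ is determined only almost everywhere, "$\tilde f$ is continuous" means that there is a continuous function $g$ on $\mathbb{R}$ with $\lim_{h\to0+}\tilde f(x,h)=g(x)$ for almost every $x$. (1) Let $f$ be continuous and $2\pi$-periodic. Then $\tilde f$ is continuous if and only if $\tilde f(x,h)$ converges as $h\to0+$ uniformly in $x\in\mathbb{R}$. (2) Let $u$ be a continuous real-valued function on the unit circle $T=\{z\in\mathbb{C}:|z|=1\}$ and put $f(x)=u(e^{ix})$. Then there is a function $F$, continuous on the closed unit disc and holomorphic in the open unit disc, with $\operatorname{Re}F=u$ on $T$, if and only if $\tilde f(x,h)$ converges as $h\to0+$ uniformly in $x\in\mathbb{R}$. -/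

import Mathlib

open Filter Topology MeasureTheory

noncomputable section

/-- The truncated conjugate integral
`f̃(x, h) = -(1/π) ∫_h^π [f(x+t) - f(x-t)] · ½ cot(½ t) dt`. -/
def truncatedConjugate {𝕜 : Type*} [RCLike 𝕜] (f : ℝ → 𝕜) (h x : ℝ) : 𝕜 :=
  -(1 / Real.pi : ℝ) •
    ∫ t in h..Real.pi, ((1 / 2 : ℝ) * Real.cot (t / 2)) • (f (x + t) - f (x - t))

/-- `g` is (a version of) the conjugate function `f̃`: at almost every `x`, the principal value
`f̃(x) = lim_{h → 0+} f̃(x, h)` exists and equals `g x`. As `f̃` is only determined almost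
everywhere, `g` is unique up to null sets. -/
def IsConjugateFunction {𝕜 : Type*} [RCLike 𝕜] (f g : ℝ → 𝕜) : Prop :=
  ∀ᵐ x : ℝ, Tendsto (fun h : ℝ => truncatedConjugate f h x) (𝓝[>] 0) (𝓝 (g x))

/-- The conjugate function of `f` is continuous (i.e. has a continuous version). -/
def HasContinuousConjugate {𝕜 : Type*} [RCLike 𝕜] (f : ℝ → 𝕜) : Prop :=
  ∃ g : ℝ → 𝕜, Continuous g ∧ IsConjugateFunction f g

/-- `f̃(x, h)` converges, uniformly in `x ∈ ℝ`, as `h → 0+`. -/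
def TruncatedConjugateConvergesUniformly {𝕜 : Type*} [RCLike 𝕜] (f : ℝ → 𝕜) : Prop :=
  ∃ g : ℝ → 𝕜, TendstoUniformly (fun h x : ℝ => truncatedConjugate f h x) g (𝓝[>] 0)

/-- `F` belongs to the disc algebra: continuous on the closed unit disc and holomorphic in the
open unit disc (only the values of `F` on the closed disc matter). -/
def InDiscAlgebra (F : ℂ → ℂ) : Prop :=
  ContinuousOn F (Metric.closedBall 0 1) ∧ DifferentiableOn ℂ F (Metric.ball 0 1)

end

/-! Let f be real and H = `herglotzTransform f`, so Re H and Im H are the Poisson and conjugate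
Poisson integrals of f. As h → 0+, Re H((1-h)e^{ix}) → f(x) uniformly, and Im H((1-h)e^{ix}) minus
the truncated conjugate integral tends to 0 uniformly: the conjugate kernel on (0,h], and its
difference from ½cot(t/2) on (h,π], are both O(h/(h²+t²)), a kernel of bounded mass. Uniform
convergence of the truncations is thus uniform radial convergence of Im H.

If the conjugate function has a continuous version g, then Im H → g radially almost everywhere. The
crux is that Im H is then the Poisson integral of g (`im_herglotzTransform_eq_re_of_ae_tendsto`),
whence uniform convergence. The mean value property of H² bounds Im H in L² on circles; with a.e.
convergence this gives L¹ convergence, and the Poisson formula on the circles passes to the limit.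
Conversely, a uniform limit of the continuous truncations is continuous. Complex f splits into real
and imaginary parts.

For the disc algebra, F with real part u on T differs from H by a constant; conversely, uniform
convergence extends H continuously by f + ig. -/

/-- The denominator `|e^{it} - r|²` of the Poisson kernels, in terms of `h = 1 - r`. -/
noncomputable def poissonDenom (h t : ℝ) : ℝ := h ^ 2 + 2 * (1 - h) * (1 - Real.cos t)

/-- The function on `ℂ`, constant along rays, with boundary values `f` at `e^{ix}`, averaged
against the Herglotz–Riesz kernel over the unit circle. -/
noncomputable def herglotzTransform (f : ℝ → ℝ) (w : ℂ) : ℂ :=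
  Real.circleAverage (fun ζ ↦ herglotzRieszKernel 0 w ζ • ((f ζ.arg : ℝ) : ℂ)) 0 1

/-! ### Bounds for the Poisson and conjugate kernels -/

/-- The 5 comes from 1 - cos t ≥ 2t²/π² on [-π, π] with π² ≤ 10; the factor 2(1-h) is at least 1. -/
lemma poissonDenom_lower {h t : ℝ} (hh : h ≤ 1 / 2) (ht : |t| ≤ Real.pi) :
    (h ^ 2 + t ^ 2) / 5 ≤ poissonDenom h t := by
  have h1 := Real.cos_le_one_sub_mul_cos_sq ht
  have h2 : Real.pi ^ 2 ≤ 10 := by nlinarith [Real.pi_lt_d2, Real.pi_pos]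
  have h3 : 1 / 5 ≤ 2 / Real.pi ^ 2 := by
    rw [div_le_div_iff₀ (by norm_num) (by positivity)]; linarith
  have h4 : t ^ 2 / 5 ≤ 1 - Real.cos t := by nlinarith [sq_nonneg t]
  unfold poissonDenom
  nlinarith [Real.cos_le_one t, sq_nonneg h]

lemma poissonDenom_pos {h : ℝ} (h0 : 0 < h) (hh : h ≤ 1) (t : ℝ) : 0 < poissonDenom h t := by
  have := Real.cos_le_one t
  have : 0 ≤ 2 * (1 - h) * (1 - Real.cos t) := by
    apply mul_nonneg <;> linarith
  unfold poissonDenom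
  positivity

lemma continuous_poissonDenom (h : ℝ) : Continuous (poissonDenom h) := by
  unfold poissonDenom; fun_prop

lemma poisson_kernel_bound {h t : ℝ} (h0 : 0 < h) (hh : h ≤ 1 / 2) (ht : |t| ≤ Real.pi) :
    |h * (2 - h) / poissonDenom h t| ≤ 10 * (h / (h ^ 2 + t ^ 2)) := by
  have h1 := poissonDenom_lower hh ht
  have h2 : 0 < h ^ 2 + t ^ 2 := by positivity
  have h3 := poissonDenom_pos h0 (by linarith) t
  rw [abs_of_nonneg (div_nonneg (mul_nonneg h0.le (by linarith)) h3.le), ← mul_div_assoc,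
    div_le_div_iff₀ h3 h2]
  calc h * (2 - h) * (h ^ 2 + t ^ 2) ≤ h * 2 * (h ^ 2 + t ^ 2) := by gcongr; linarith
    _ ≤ h * 2 * (5 * poissonDenom h t) := by gcongr; linarith
    _ = _ := by ring

lemma conjugate_kernel_bound_near {h t : ℝ} (h0 : 0 < h) (hh : h ≤ 1 / 2) (ht : 0 ≤ t)
    (hth : t ≤ h) :
    |(1 - h) * Real.sin t / poissonDenom h t| ≤ 10 * (h / (h ^ 2 + t ^ 2)) := by
  have hpi := Real.pi_gt_three
  have h1 := poissonDenom_lower hh (t := t) (by rw [abs_of_nonneg ht]; linarith)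
  have h2 : 0 < h ^ 2 + t ^ 2 := by positivity
  have h3 := poissonDenom_pos h0 (by linarith) t
  have h4 : 0 ≤ Real.sin t := Real.sin_nonneg_of_nonneg_of_le_pi ht (by linarith)
  have h5 : Real.sin t ≤ t := Real.sin_le ht
  rw [abs_of_nonneg (div_nonneg (mul_nonneg (by linarith) h4) h3.le), ← mul_div_assoc,
    div_le_div_iff₀ h3 h2]
  calc (1 - h) * Real.sin t * (h ^ 2 + t ^ 2) ≤ 1 * h * (h ^ 2 + t ^ 2) := by
        gcongr <;> linarith
    _ ≤ 1 * h * (10 * poissonDenom h t) := by gcongr; linarith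
    _ = _ := by ring

/-- The denominator equals h² + 4(1-h)sin²(t/2), so the conjugate kernel would be exactly ½cot(t/2)
without its h² term. -/
lemma conjugate_kernel_sub_cot {h t : ℝ} (h0 : 0 < h) (hh : h ≤ 1) (ht : 0 < t)
    (htpi : t ≤ Real.pi) :
    1 / 2 * Real.cot (t / 2) - (1 - h) * Real.sin t / poissonDenom h t
      = h ^ 2 * (1 / 2 * Real.cot (t / 2)) / poissonDenom h t := by
  have hd := (poissonDenom_pos h0 hh t).ne'
  have hs : Real.sin (t / 2) ≠ 0 :=
    (Real.sin_pos_of_pos_of_lt_pi (by linarith) (by linarith)).ne'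
  rw [Real.cot_eq_cos_div_sin]
  have e1 : Real.sin t = 2 * Real.sin (t / 2) * Real.cos (t / 2) := by
    rw [← Real.sin_two_mul]; ring_nf
  have e2 : poissonDenom h t = h ^ 2 + 4 * (1 - h) * Real.sin (t / 2) ^ 2 := by
    have : Real.cos t = 1 - 2 * Real.sin (t / 2) ^ 2 := by
      rw [← Real.cos_sq_add_sin_sq (t / 2)]
      have := Real.cos_two_mul' (t / 2)
      rw [show 2 * (t / 2) = t by ring] at this
      linarith
    rw [poissonDenom, this]; ring
  have key : (1 - h) * Real.sin t * Real.sin (t / 2) * 2 =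
      Real.cos (t / 2) * (poissonDenom h t - h ^ 2) := by rw [e1, e2]; ring
  field_simp
  linear_combination -key

lemma cot_half_le {t : ℝ} (ht : 0 < t) (htpi : t ≤ Real.pi) :
    0 ≤ 1 / 2 * Real.cot (t / 2) ∧ 1 / 2 * Real.cot (t / 2) ≤ 1 / t := by
  have hs : 0 < Real.sin (t / 2) :=
    Real.sin_pos_of_pos_of_lt_pi (by linarith) (by linarith)
  have hc : 0 ≤ Real.cos (t / 2) := Real.cos_nonneg_of_mem_Icc ⟨by linarith, by linarith⟩
  rw [Real.cot_eq_cos_div_sin]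
  refine ⟨by positivity, ?_⟩
  rcases htpi.eq_or_lt with rfl | hlt
  · simp [Real.pi_pos.le]
  · have h1 := (Real.lt_tan (x := t / 2) (by linarith) (by linarith)).le
    have hc' : 0 < Real.cos (t / 2) := Real.cos_pos_of_mem_Ioo ⟨by linarith, by linarith⟩
    rw [Real.tan_eq_sin_div_cos, le_div_iff₀ hc'] at h1
    rw [← mul_div_assoc, div_le_div_iff₀ hs ht]
    linarith

/-- Here ½cot(t/2) ≤ 1/t ≤ 1/h reduces the factor h² of the difference to h. -/
lemma conjugate_kernel_bound_far {h t : ℝ} (h0 : 0 < h) (hh : h ≤ 1 / 2) (ht : h ≤ t)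
    (htpi : t ≤ Real.pi) :
    |1 / 2 * Real.cot (t / 2) - (1 - h) * Real.sin t / poissonDenom h t|
      ≤ 10 * (h / (h ^ 2 + t ^ 2)) := by
  have t0 : 0 < t := by linarith
  have h1 := poissonDenom_lower hh (t := t) (by rw [abs_of_nonneg t0.le]; linarith)
  have h2 : 0 < h ^ 2 + t ^ 2 := by positivity
  have h3 := poissonDenom_pos h0 (by linarith) t
  obtain ⟨c0, c1⟩ := cot_half_le t0 htpi
  have c2 : 1 / 2 * Real.cot (t / 2) ≤ 1 / h := c1.trans (by gcongr)
  rw [conjugate_kernel_sub_cot h0 (by linarith) t0 htpi, abs_of_nonneg (by positivity),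
    ← mul_div_assoc, div_le_div_iff₀ h3 h2]
  calc h ^ 2 * (1 / 2 * Real.cot (t / 2)) * (h ^ 2 + t ^ 2)
      ≤ h ^ 2 * (1 / h) * (10 * poissonDenom h t) := by gcongr; linarith
    _ = _ := by field_simp

lemma integral_div_sq_add_sq_le {h : ℝ} (h0 : 0 < h) :
    ∫ t in 0..Real.pi, h / (h ^ 2 + t ^ 2) ≤ Real.pi / 2 := by
  have e : ∀ t : ℝ, h / (h ^ 2 + t ^ 2) = h⁻¹ * (1 + (t / h) ^ 2)⁻¹ := by
    intro t; field_simp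
  simp_rw [e]
  rw [intervalIntegral.integral_const_mul, intervalIntegral.integral_comp_div (fun t ↦ (1 + t ^ 2)⁻¹)
    h0.ne', integral_inv_one_add_sq, smul_eq_mul, inv_mul_cancel_left₀ h0.ne']
  simpa using (Real.arctan_lt_pi_div_two _).le

lemma continuous_div_sq_add_sq {h : ℝ} (h0 : 0 < h) :
    Continuous fun t : ℝ ↦ h / (h ^ 2 + t ^ 2) :=
  continuous_const.div (by fun_prop) fun t ↦ by positivity

/-- Integrals against a kernel dominated by `h / (h² + t²)` of functions that are small near `0`
are small. -/
lemma abs_integral_le_of_kernel_bound {h C ε M : ℝ} {ψ : ℝ → ℝ} (h0 : 0 < h) (hC : 0 ≤ C)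
    (hε : 0 ≤ ε) (hM : 0 ≤ M)
    (hψ : ∀ t, 0 < t → t ≤ Real.pi → |ψ t| ≤ C * (h / (h ^ 2 + t ^ 2)) * (ε + M * t ^ 2)) :
    |∫ t in 0..Real.pi, ψ t| ≤ C * (ε * (Real.pi / 2) + M * h * Real.pi) := by
  have hc := continuous_div_sq_add_sq h0
  have hle : ‖∫ t in 0..Real.pi, ψ t‖ ≤
      ∫ t in 0..Real.pi, (C * ε * (h / (h ^ 2 + t ^ 2)) + C * M * h) := by
    refine intervalIntegral.norm_integral_le_of_norm_le Real.pi_pos.le (.of_forall ?_)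
      (Continuous.intervalIntegrable (by fun_prop) _ _)
    intro t ht
    refine (hψ t ht.1 ht.2).trans ?_
    have h2 : 0 < h ^ 2 + t ^ 2 := by positivity
    -- The kernel absorbs the growth t², so the M-term contributes only O(h).
    have h3 : h / (h ^ 2 + t ^ 2) * t ^ 2 ≤ h := by
      rw [div_mul_eq_mul_div, div_le_iff₀ h2]; nlinarith [pow_pos h0 3]
    have h4 := mul_le_mul_of_nonneg_left h3 (mul_nonneg hC hM)
    linarith
  rw [intervalIntegral.integral_add (Continuous.intervalIntegrable (by fun_prop) _ _)
    (by simp), intervalIntegral.integral_const_mul, intervalIntegral.integral_const] at hle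
  refine hle.trans ?_
  have := mul_le_mul_of_nonneg_left (integral_div_sq_add_sq_le h0) (mul_nonneg hC hε)
  simp only [smul_eq_mul, sub_zero]
  linarith

/-! ### Continuous periodic functions -/

lemma Function.Periodic.uniformContinuous {E : Type*} [UniformSpace E] {f : ℝ → E} {c : ℝ}
    (hc : 0 < c) (hf : Continuous f) (hp : Function.Periodic f c) : UniformContinuous f := by
  have : Fact (0 < c) := ⟨hc⟩
  have h1 : Continuous (hp.lift : AddCircle c → E) := hf.quotient_lift _
  have h2 : UniformContinuous (QuotientAddGroup.mk' (AddSubgroup.zmultiples c)) :=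
    uniformContinuous_of_continuousAt_zero _ (continuous_quotient_mk'.continuousAt)
  exact (CompactSpace.uniformContinuous_of_continuous h1).comp h2

/-- Uniform continuity handles |t| < δ; beyond that, boundedness is hidden in M t². One inequality
for all t avoids splitting the integrals at δ. -/
lemma exists_abs_sub_le_add_mul_sq {f : ℝ → ℝ} (hf : Continuous f)
    (hp : Function.Periodic f (2 * Real.pi)) {ε : ℝ} (hε : 0 < ε) :
    ∃ M, 0 ≤ M ∧ ∀ x t, |f (x + t) - f x| ≤ ε + M * t ^ 2 := by
  have hu : UniformContinuous f := hp.uniformContinuous (by positivity) hf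
  obtain ⟨B, hB⟩ := (hp.isBounded_of_continuous (by positivity) hf).exists_norm_le
  obtain ⟨δ, hδ, H⟩ := Metric.uniformContinuous_iff.1 hu ε hε
  have hB' : ∀ x, |f x| ≤ B := fun x ↦ hB _ ⟨x, rfl⟩
  have B0 : 0 ≤ B := (abs_nonneg _).trans (hB' 0)
  refine ⟨2 * B / δ ^ 2, by positivity, fun x t ↦ ?_⟩
  by_cases ht : |t| < δ
  · have := (H (a := x + t) (b := x) (by simpa [Real.dist_eq] using ht)).le
    rw [Real.dist_eq] at this
    have : 0 ≤ 2 * B / δ ^ 2 * t ^ 2 := by positivity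
    linarith
  · have h1 : δ ^ 2 ≤ t ^ 2 := by
      rw [← sq_abs t]; gcongr; exact not_lt.1 ht
    have h2 : 2 * B ≤ 2 * B / δ ^ 2 * t ^ 2 := by
      rw [div_mul_eq_mul_div, le_div_iff₀ (by positivity)]; gcongr
    have := abs_sub (f (x + t)) (f x)
    linarith [hB' (x + t), hB' x]

lemma Function.Periodic.comp_arg_circleMap {E : Type*} {f : ℝ → E}
    (hp : Function.Periodic f (2 * Real.pi)) {r : ℝ} (hr : 0 < r) (θ : ℝ) :
    f (circleMap 0 r θ).arg = f θ := by
  have : ((circleMap 0 r θ).arg : Real.Angle) = θ := by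
    rw [circleMap_zero, Complex.arg_real_mul _ hr, Complex.arg_exp_mul_I,
      Real.Angle.coe_toIocMod]
  obtain ⟨k, hk⟩ := Real.Angle.angle_eq_iff_two_pi_dvd_sub.1 this
  have hk' : (circleMap 0 r θ).arg = θ + k * (2 * Real.pi) := by linarith
  rw [hk']
  exact hp.int_mul k θ

lemma Function.Periodic.integral_eq_integral_add_neg {G : ℝ → ℝ} (hc : Continuous G)
    (hp : Function.Periodic G (2 * Real.pi)) :
    ∫ t in 0..2 * Real.pi, G t = ∫ t in 0..Real.pi, (G t + G (-t)) := by
  have h1 := hp.intervalIntegral_add_eq 0 (-Real.pi)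
  rw [zero_add, show -Real.pi + 2 * Real.pi = Real.pi by ring] at h1
  rw [h1, ← intervalIntegral.integral_add_adjacent_intervals (b := 0) (hc.intervalIntegrable _ _)
    (hc.intervalIntegrable _ _), intervalIntegral.integral_add (hc.intervalIntegrable _ _)
    (Continuous.intervalIntegrable (by fun_prop) _ _), intervalIntegral.integral_comp_neg]
  simp [add_comm]

/-! ### The Herglotz transform in polar coordinates and the Poisson formula -/

lemma herglotzRieszKernel_circleMap {h : ℝ} (h0 : 0 < h) (hh : h ≤ 1) (x θ : ℝ) :
    herglotzRieszKernel 0 (circleMap 0 (1 - h) x) (circleMap 0 1 (θ + x)) =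
      ((h * (2 - h) / poissonDenom h θ : ℝ) : ℂ) +
        ((-(2 * ((1 - h) * Real.sin θ / poissonDenom h θ)) : ℝ) : ℂ) * Complex.I := by
  have hd := (poissonDenom_pos h0 hh θ).ne'
  have hx : Complex.exp (x * Complex.I) ≠ 0 := Complex.exp_ne_zero _
  have e : Complex.exp (((θ + x : ℝ) : ℂ) * Complex.I)
      = Complex.exp (x * Complex.I) * Complex.exp (θ * Complex.I) := by
    rw [← Complex.exp_add]; push_cast; ring_nf
  rw [herglotzRieszKernel_def, circleMap_zero, circleMap_zero, e]
  simp only [sub_zero, Complex.ofReal_one, one_mul]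
  have e2 : Complex.exp (x * Complex.I) * Complex.exp (θ * Complex.I)
      + ((1 - h : ℝ) : ℂ) * Complex.exp (x * Complex.I)
      = Complex.exp (x * Complex.I) * (Complex.exp (θ * Complex.I) + ((1 - h : ℝ) : ℂ)) := by ring
  have e3 : Complex.exp (x * Complex.I) * Complex.exp (θ * Complex.I)
      - ((1 - h : ℝ) : ℂ) * Complex.exp (x * Complex.I)
      = Complex.exp (x * Complex.I) * (Complex.exp (θ * Complex.I) - ((1 - h : ℝ) : ℂ)) := by ring
  rw [e2, e3, mul_div_mul_left _ _ hx]
  have hn : Complex.normSq (Complex.exp (θ * Complex.I) - ((1 - h : ℝ) : ℂ))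
      = poissonDenom h θ := by
    rw [Complex.normSq_apply]
    simp only [Complex.sub_re, Complex.sub_im, Complex.exp_ofReal_mul_I_re,
      Complex.exp_ofReal_mul_I_im, Complex.ofReal_re, Complex.ofReal_im, poissonDenom]
    linear_combination Real.sin_sq_add_cos_sq θ
  apply Complex.ext
  · rw [Complex.div_re, hn]
    simp
    field_simp
    linear_combination Real.sin_sq_add_cos_sq θ
  · rw [Complex.div_im, hn]
    simp
    field_simp
    simp only [← Complex.ofReal_sin, Complex.ofReal_re]
    ring

lemma poissonDenom_periodic (h : ℝ) : Function.Periodic (poissonDenom h) (2 * Real.pi) := by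
  intro t; simp [poissonDenom]

lemma poissonDenom_neg (h t : ℝ) : poissonDenom h (-t) = poissonDenom h t := by
  simp [poissonDenom]

/-- Rotating by x and folding [-π, 0] onto [0, π] turns the even Poisson kernel into a sum of values
of f and the odd conjugate kernel into a difference. -/
lemma herglotzTransform_circleMap {f : ℝ → ℝ} (hf : Continuous f)
    (hp : Function.Periodic f (2 * Real.pi)) {h : ℝ} (h0 : 0 < h) (hh : h ≤ 1) (x : ℝ) :
    herglotzTransform f (circleMap 0 (1 - h) x) =
      (((2 * Real.pi)⁻¹ * ∫ t in 0..Real.pi,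
        h * (2 - h) / poissonDenom h t * (f (x + t) + f (x - t)) : ℝ) : ℂ) +
      ((-(Real.pi⁻¹ * ∫ t in 0..Real.pi,
        (1 - h) * Real.sin t / poissonDenom h t * (f (x + t) - f (x - t))) : ℝ) : ℂ) *
        Complex.I := by
  have hd : ∀ t, poissonDenom h t ≠ 0 := fun t ↦ (poissonDenom_pos h0 hh t).ne'
  have hdc := continuous_poissonDenom h
  set P : ℝ → ℝ := fun θ ↦ h * (2 - h) / poissonDenom h θ with hP
  set Q : ℝ → ℝ := fun θ ↦ (1 - h) * Real.sin θ / poissonDenom h θ with hQ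
  have hPc : Continuous P := by fun_prop (disch := exact hd _)
  have hQc : Continuous Q := by fun_prop (disch := exact hd _)
  have hPp : Function.Periodic P (2 * Real.pi) := fun t ↦ by
    simp only [hP, poissonDenom_periodic h t]
  have hQp : Function.Periodic Q (2 * Real.pi) := fun t ↦ by
    simp only [hQ, poissonDenom_periodic h t, Real.sin_add_two_pi]
  have hfs : Function.Periodic (fun θ ↦ f (θ + x)) (2 * Real.pi) := fun t ↦ by
    simp only [← hp (t + x)]; ring_nf
  have e1 : ∀ θ : ℝ, herglotzRieszKernel 0 (circleMap 0 (1 - h) x) (circleMap 0 1 (θ + x)) •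
      ((f (circleMap 0 1 (θ + x)).arg : ℝ) : ℂ) =
      ((P θ * f (θ + x) : ℝ) : ℂ) + ((-2 * (Q θ * f (θ + x)) : ℝ) : ℂ) * Complex.I := by
    intro θ
    rw [herglotzRieszKernel_circleMap h0 hh, hp.comp_arg_circleMap one_pos]
    simp only [smul_eq_mul, hP, hQ]
    push_cast
    ring
  have i1 : Continuous fun θ ↦ P θ * f (θ + x) := by fun_prop
  have i2 : Continuous fun θ ↦ Q θ * f (θ + x) := by fun_prop
  rw [herglotzTransform, Real.circleAverage_eq_integral_add x]
  simp_rw [e1]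
  rw [intervalIntegral.integral_add (Continuous.intervalIntegrable (by fun_prop) _ _)
    (Continuous.intervalIntegrable (by fun_prop) _ _), intervalIntegral.integral_mul_const,
    intervalIntegral.integral_ofReal, intervalIntegral.integral_ofReal,
    intervalIntegral.integral_const_mul,
    Function.Periodic.integral_eq_integral_add_neg i1 (hPp.mul hfs),
    Function.Periodic.integral_eq_integral_add_neg i2 (hQp.mul hfs)]
  have e2 : ∀ t, P t * f (t + x) + P (-t) * f (-t + x) = P t * (f (x + t) + f (x - t)) := by
    intro t
    simp only [hP, poissonDenom_neg, add_comm _ x, ← sub_eq_add_neg]; ring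
  have e3 : ∀ t, Q t * f (t + x) + Q (-t) * f (-t + x) = Q t * (f (x + t) - f (x - t)) := by
    intro t
    simp only [hQ, poissonDenom_neg, Real.sin_neg, add_comm _ x, ← sub_eq_add_neg]; ring
  simp_rw [e2, e3]
  change _ = (((2 * Real.pi)⁻¹ * ∫ t in 0..Real.pi, P t * (f (x + t) + f (x - t)) : ℝ) : ℂ) +
    ((-(Real.pi⁻¹ * ∫ t in 0..Real.pi, Q t * (f (x + t) - f (x - t))) : ℝ) : ℂ) * Complex.I
  generalize (∫ t in 0..Real.pi, P t * (f (x + t) + f (x - t))) = I₁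
  generalize (∫ t in 0..Real.pi, Q t * (f (x + t) - f (x - t))) = I₂
  rw [Complex.real_smul]
  push_cast
  field_simp

lemma circleMap_arg_of_norm_eq_one {z : ℂ} (hz : ‖z‖ = 1) : circleMap 0 1 z.arg = z := by
  rw [circleMap_zero]
  simpa [hz] using Complex.norm_mul_exp_arg_mul_I z

lemma circleMap_one_sub_mem_ball {h : ℝ} (h0 : 0 < h) (hh : h ≤ 1) (x : ℝ) :
    circleMap 0 (1 - h) x ∈ Metric.ball (0 : ℂ) 1 := by
  rw [mem_ball_zero_iff, norm_circleMap_zero, abs_of_nonneg (sub_nonneg.2 hh)]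
  linarith

lemma circleIntegrable_comp_arg {f : ℝ → ℝ} (hf : Continuous f)
    (hp : Function.Periodic f (2 * Real.pi)) : CircleIntegrable (fun ζ ↦ f ζ.arg) 0 1 := by
  simp only [CircleIntegrable, hp.comp_arg_circleMap one_pos]
  exact hf.intervalIntegrable _ _

/-- The Poisson integral of the boundary values of the real or imaginary part of a function of the
disc algebra. -/
lemma re_herglotzTransform_eq {F : ℂ → ℂ} (hF : DiffContOnCl ℂ F (Metric.ball 0 1))
    (T : ℂ →L[ℝ] ℝ) {f : ℝ → ℝ} (hf : Continuous f) (hp : Function.Periodic f (2 * Real.pi))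
    (hfF : ∀ θ, f θ = T (F (circleMap 0 1 θ))) {w : ℂ} (hw : w ∈ Metric.ball (0 : ℂ) 1) :
    (herglotzTransform f w).re = T (F w) := by
  -- The Poisson kernel is real, so averaging against it commutes with the real-linear `T`.
  rw [herglotzTransform, re_circleAverage_herglotzRieszKernel_smul
    (circleIntegrable_comp_arg hf hp) hw, ← hF.circleAverage_re_herglotzRieszKernel_smul hw,
    ← T.circleAverage_comp_comm]
  · apply Real.circleAverage_congr_sphere
    intro z hz
    have hz' : ‖z‖ = 1 := by simpa using hz
    simp only [Pi.smul_apply', Function.comp_apply, hfF, circleMap_arg_of_norm_eq_one hz', map_smul]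
  · apply ContinuousOn.circleIntegrable zero_le_one
    have h1 : ContinuousOn (herglotzRieszKernel 0 w) (Metric.sphere 0 1) := by
      simpa using continuousOn_herglotzRieszKernel_sphere hw
    have h2 : ContinuousOn F (Metric.sphere 0 1) := hF.2.mono <| by
      rw [closure_ball _ one_ne_zero]; exact Metric.sphere_subset_closedBall
    exact (Complex.continuous_re.comp_continuousOn h1).smul h2

lemma herglotzTransform_one {w : ℂ} (hw : w ∈ Metric.ball (0 : ℂ) 1) :
    (herglotzTransform (fun _ ↦ 1) w).re = 1 :=
  re_herglotzTransform_eq (F := fun _ ↦ 1) diffContOnCl_const Complex.reCLM continuous_const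
    (fun _ ↦ rfl) (fun _ ↦ rfl) hw

/-- The mass is read off from the Poisson formula for the constant 1, with no explicit integration.
-/
lemma integral_poisson_kernel {h : ℝ} (h0 : 0 < h) (hh : h ≤ 1) :
    ∫ t in 0..Real.pi, h * (2 - h) / poissonDenom h t = Real.pi := by
  have h1 := herglotzTransform_one (w := circleMap 0 (1 - h) 0)
    (circleMap_one_sub_mem_ball h0 hh 0)
  rw [herglotzTransform_circleMap continuous_const (fun _ ↦ rfl) h0 hh] at h1
  rw [Complex.add_re, Complex.ofReal_re, Complex.re_ofReal_mul, Complex.I_re, mul_zero, add_zero,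
    intervalIntegral.integral_mul_const] at h1
  field_simp at h1
  linarith

/-! ### Uniform radial asymptotics -/

/-- The Poisson integral of a continuous periodic function converges uniformly to it. -/
theorem tendstoUniformly_re_herglotzTransform {f : ℝ → ℝ} (hf : Continuous f)
    (hp : Function.Periodic f (2 * Real.pi)) :
    TendstoUniformly (fun h x : ℝ ↦ (herglotzTransform f (circleMap 0 (1 - h) x)).re) f
      (𝓝[>] 0) := by
  rw [Metric.tendstoUniformly_iff]
  intro ε hε
  -- The 20 makes the final bound ε/4 + 10Mh.
  obtain ⟨M, hM, H⟩ := exists_abs_sub_le_add_mul_sq hf hp (show 0 < ε / 20 by positivity)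
  have hlim : Tendsto (fun h : ℝ ↦ 10 * M * h) (𝓝[>] 0) (𝓝 0) := by
    have : Continuous fun h : ℝ ↦ 10 * M * h := by fun_prop
    simpa using (this.tendsto 0).mono_left nhdsWithin_le_nhds
  filter_upwards [hlim.eventually_lt_const (show 0 < ε / 4 by positivity),
    Ioc_mem_nhdsGT (show (0 : ℝ) < 1 / 2 by norm_num)] with h hsmall ⟨h0, hh⟩ x
  have hd : ∀ t, poissonDenom h t ≠ 0 := fun t ↦ (poissonDenom_pos h0 (by linarith) t).ne'
  have hdc := continuous_poissonDenom h
  have e : (herglotzTransform f (circleMap 0 (1 - h) x)).re - f x = (2 * Real.pi)⁻¹ *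
      ∫ t in 0..Real.pi,
        h * (2 - h) / poissonDenom h t * ((f (x + t) - f x) + (f (x - t) - f x)) := by
    have e1 : ∀ t, h * (2 - h) / poissonDenom h t * ((f (x + t) - f x) + (f (x - t) - f x)) =
      h * (2 - h) / poissonDenom h t * (f (x + t) + f (x - t))
        - h * (2 - h) / poissonDenom h t * (2 * f x) := fun t ↦ by ring
    simp_rw [e1]
    rw [intervalIntegral.integral_sub
      (Continuous.intervalIntegrable (by fun_prop (disch := exact hd _)) _ _)
      (Continuous.intervalIntegrable (by fun_prop (disch := exact hd _)) _ _),
      intervalIntegral.integral_mul_const, integral_poisson_kernel h0 (by linarith),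
      herglotzTransform_circleMap hf hp h0 (by linarith), Complex.add_re, Complex.ofReal_re,
      Complex.re_ofReal_mul, Complex.I_re, mul_zero, add_zero]
    field_simp
  have b := abs_integral_le_of_kernel_bound (ψ := fun t ↦
      h * (2 - h) / poissonDenom h t * ((f (x + t) - f x) + (f (x - t) - f x)))
    (C := 10) (ε := 2 * (ε / 20)) (M := 2 * M) h0 (by norm_num) (by positivity) (by positivity) (by
      intro t ht htpi
      rw [abs_mul]
      have := H x (-t)
      rw [neg_sq, ← sub_eq_add_neg] at this
      gcongr
      · exact poisson_kernel_bound h0 hh (by rwa [abs_of_pos ht])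
      · refine (abs_add_le _ _).trans ?_
        linarith [H x t])
  rw [dist_comm, Real.dist_eq, e, abs_mul, abs_of_pos (by positivity)]
  calc _ ≤ (2 * Real.pi)⁻¹ * (10 * (2 * (ε / 20) * (Real.pi / 2) + 2 * M * h * Real.pi)) := by
        gcongr
    _ = ε / 4 + 10 * M * h := by field_simp; ring
    _ < ε := by linarith

lemma intervalIntegrable_cot_smul {𝕜 : Type*} [RCLike 𝕜] {φ : ℝ → 𝕜} (hφ : Continuous φ) {h : ℝ}
    (h0 : 0 < h) (hh : h ≤ Real.pi) :
    IntervalIntegrable (fun t ↦ ((1 / 2 : ℝ) * Real.cot (t / 2)) • φ t) volume h Real.pi := by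
  apply ContinuousOn.intervalIntegrable
  rw [Set.uIcc_of_le hh]
  have : ContinuousOn (fun t : ℝ ↦ Real.cot (t / 2)) (Set.Icc h Real.pi) := by
    simp_rw [Real.cot_eq_cos_div_sin]
    refine ContinuousOn.div (by fun_prop) (by fun_prop) fun t ht ↦ ?_
    exact (Real.sin_pos_of_pos_of_lt_pi (by linarith [ht.1]) (by linarith [ht.2, Real.pi_pos])).ne'
  fun_prop

/-- The conjugate Poisson integral and the truncated conjugate integral differ by a uniformly
small amount. -/
theorem tendstoUniformly_im_herglotzTransform_sub {f : ℝ → ℝ} (hf : Continuous f)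
    (hp : Function.Periodic f (2 * Real.pi)) :
    TendstoUniformly (fun h x : ℝ ↦ (herglotzTransform f (circleMap 0 (1 - h) x)).im
      - truncatedConjugate f h x) (fun _ ↦ 0) (𝓝[>] 0) := by
  rw [Metric.tendstoUniformly_iff]
  intro ε hε
  obtain ⟨M, hM, H⟩ := exists_abs_sub_le_add_mul_sq hf hp (show 0 < ε / 40 by positivity)
  have hlim : Tendsto (fun h : ℝ ↦ 20 * M * h) (𝓝[>] 0) (𝓝 0) := by
    have : Continuous fun h : ℝ ↦ 20 * M * h := by fun_prop
    simpa using (this.tendsto 0).mono_left nhdsWithin_le_nhds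
  filter_upwards [hlim.eventually_lt_const (show 0 < ε / 4 by positivity),
    Ioc_mem_nhdsGT (show (0 : ℝ) < 1 / 2 by norm_num)] with h hsmall ⟨h0, hh⟩ x
  have hpi := Real.pi_gt_three
  have hd : ∀ t, poissonDenom h t ≠ 0 := fun t ↦ (poissonDenom_pos h0 (by linarith) t).ne'
  have hdc := continuous_poissonDenom h
  set A : ℝ → ℝ := fun t ↦ (1 - h) * Real.sin t / poissonDenom h t * (f (x + t) - f (x - t))
  set B : ℝ → ℝ := fun t ↦ ((1 / 2 : ℝ) * Real.cot (t / 2)) • (f (x + t) - f (x - t))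
  have hA : Continuous A := by fun_prop (disch := exact hd _)
  have hB : IntervalIntegrable B volume h Real.pi :=
    intervalIntegrable_cot_smul (by fun_prop) h0 (by linarith)
  -- Extending the cotangent integrand by zero to (0, h] lets one kernel bound on (0, π] cover the
  -- near and far ranges.
  have hBi : ∫ t in h..Real.pi, B t = ∫ t in 0..Real.pi, (Set.Ioi h).indicator B t := by
    rw [intervalIntegral.integral_of_le (by linarith), intervalIntegral.integral_of_le (by linarith),
      setIntegral_indicator measurableSet_Ioi, Set.Ioc_inter_Ioi, sup_of_le_right h0.le]
  have hBii : IntervalIntegrable ((Set.Ioi h).indicator B) volume 0 Real.pi := by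
    rw [intervalIntegrable_iff_integrableOn_Ioc_of_le (by linarith)] at hB ⊢
    rw [IntegrableOn, integrable_indicator_iff measurableSet_Ioi, IntegrableOn,
      Measure.restrict_restrict measurableSet_Ioi, Set.inter_comm, Set.Ioc_inter_Ioi,
      sup_of_le_right h0.le]
    exact hB
  have e : (herglotzTransform f (circleMap 0 (1 - h) x)).im - truncatedConjugate f h x =
      Real.pi⁻¹ * ∫ t in 0..Real.pi, ((Set.Ioi h).indicator B t - A t) := by
    rw [intervalIntegral.integral_sub hBii (hA.intervalIntegrable _ _), ← hBi,
      herglotzTransform_circleMap hf hp h0 (by linarith), truncatedConjugate]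
    simp only [Complex.add_im, Complex.ofReal_im, Complex.im_ofReal_mul, Complex.I_im, smul_eq_mul,
      A, B]
    ring
  have hAB : ∀ t, 0 < t → t ≤ Real.pi → |(Set.Ioi h).indicator B t - A t| ≤
      10 * (h / (h ^ 2 + t ^ 2)) * (2 * (ε / 40) + 2 * M * t ^ 2) := by
    intro t ht htpi
    have hφ : |f (x + t) - f (x - t)| ≤ 2 * (ε / 40) + 2 * M * t ^ 2 := by
      have := H x (-t)
      rw [neg_sq, ← sub_eq_add_neg] at this
      have h3 := abs_sub (f (x + t) - f x) (f (x - t) - f x)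
      rw [sub_sub_sub_cancel_right] at h3
      linarith [H x t]
    by_cases hth : h < t
    · rw [Set.indicator_of_mem (Set.mem_Ioi.2 hth)]
      simp only [A, B, smul_eq_mul, ← sub_mul]
      rw [abs_mul]
      gcongr
      exact conjugate_kernel_bound_far h0 hh hth.le htpi
    · rw [Set.indicator_of_notMem (by simpa using hth)]
      simp only [A, zero_sub, abs_neg]
      rw [abs_mul]
      gcongr
      exact conjugate_kernel_bound_near h0 hh ht.le (not_lt.1 hth)
  have b := abs_integral_le_of_kernel_bound h0 (by norm_num) (by positivity) (by positivity) hAB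
  rw [dist_comm, Real.dist_eq, sub_zero, e, abs_mul, abs_of_pos (by positivity)]
  calc _ ≤ Real.pi⁻¹ * (10 * (2 * (ε / 40) * (Real.pi / 2) + 2 * M * h * Real.pi)) := by
        gcongr
    _ = ε / 4 + 20 * M * h := by field_simp; ring
    _ < ε := by linarith

/-! ### Conjugate Poisson integrals with a continuous radial limit -/

lemma differentiableOn_herglotzTransform {f : ℝ → ℝ} (hf : Continuous f)
    (hp : Function.Periodic f (2 * Real.pi)) :
    DifferentiableOn ℂ (herglotzTransform f) (Metric.ball 0 1) := by
  apply differentiableOn_circleAverage_herglotzRieszKernel_smul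
  simp only [CircleIntegrable, hp.comp_arg_circleMap one_pos]
  exact (Complex.continuous_ofReal.comp hf).intervalIntegrable _ _

lemma continuous_herglotzTransform_circleMap {f : ℝ → ℝ} (hf : Continuous f)
    (hp : Function.Periodic f (2 * Real.pi)) {h : ℝ} (h0 : 0 < h) (hh : h ≤ 1) :
    Continuous fun θ ↦ herglotzTransform f (circleMap 0 (1 - h) θ) :=
  (differentiableOn_herglotzTransform hf hp).continuousOn.comp_continuous
    (continuous_circleMap 0 _) (circleMap_one_sub_mem_ball h0 hh)

/-- The conjugate Poisson integrals of a continuous function are bounded in `L²`. -/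
lemma exists_integral_im_herglotzTransform_sq_le {f : ℝ → ℝ} (hf : Continuous f)
    (hp : Function.Periodic f (2 * Real.pi)) :
    ∃ C, ∀ᶠ h in 𝓝[>] (0 : ℝ),
      ∫ θ in 0..2 * Real.pi, (herglotzTransform f (circleMap 0 (1 - h) θ)).im ^ 2 ≤ C := by
  obtain ⟨B, hB⟩ := (hp.isBounded_of_continuous (by positivity) hf).exists_norm_le
  have hB' : ∀ x, |f x| ≤ B := fun x ↦ hB _ ⟨x, rfl⟩
  -- The mean value of Re H² = (Re H)² - (Im H)² is Re H(0)²; near the circle |Re H| ≤ B + 1 by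
  -- uniform convergence.
  refine ⟨2 * Real.pi * (B + 1) ^ 2 - 2 * Real.pi * (herglotzTransform f 0 ^ 2).re, ?_⟩
  filter_upwards [Metric.tendstoUniformly_iff.1 (tendstoUniformly_re_herglotzTransform hf hp) 1
    one_pos, Ioc_mem_nhdsGT (show (0 : ℝ) < 1 by norm_num)] with h hU ⟨h0, hh⟩
  have hc := continuous_herglotzTransform_circleMap hf hp h0 hh
  have hd : DiffContOnCl ℂ (fun z ↦ herglotzTransform f z ^ 2) (Metric.ball 0 |1 - h|) := by
    apply DifferentiableOn.diffContOnCl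
    refine ((differentiableOn_herglotzTransform hf hp).pow 2).mono
      (Metric.closure_ball_subset_closedBall.trans (Metric.closedBall_subset_ball ?_))
    rw [abs_of_nonneg (by linarith)]; linarith
  have hm := congrArg Complex.re hd.circleAverage
  rw [Real.circleAverage_def, Complex.real_smul, Complex.re_ofReal_mul, ← Complex.reCLM_apply,
    ← ContinuousLinearMap.intervalIntegral_comp_comm _
      (Continuous.intervalIntegrable (by fun_prop) _ _)] at hm
  have e : ∀ z : ℂ, Complex.reCLM (z ^ 2) = z.re ^ 2 - z.im ^ 2 := fun z ↦ by
    simp [sq]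
  simp_rw [e] at hm
  rw [intervalIntegral.integral_sub (Continuous.intervalIntegrable (by fun_prop) _ _)
    (Continuous.intervalIntegrable (by fun_prop) _ _)] at hm
  have hu : ∫ θ in 0..2 * Real.pi, (herglotzTransform f (circleMap 0 (1 - h) θ)).re ^ 2
      ≤ ∫ θ in 0..2 * Real.pi, (B + 1) ^ 2 := by
    refine intervalIntegral.integral_mono_on (by positivity)
      (Continuous.intervalIntegrable (by fun_prop) _ _)
      (Continuous.intervalIntegrable (by fun_prop) _ _) fun θ _ ↦ ?_
    have h1 := hU θ
    rw [Real.dist_eq, abs_lt] at h1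
    have h2 := abs_le.1 (hB' θ)
    apply sq_le_sq' <;> linarith
  rw [intervalIntegral.integral_const, smul_eq_mul, sub_zero] at hu
  rw [inv_mul_eq_iff_eq_mul₀ (by positivity)] at hm
  linarith

/-- Functions bounded in `L²` that converge to `0` almost everywhere converge to `0` in `L¹`. -/
lemma tendsto_integral_abs_zero_of_sq_bound {ι : Type*} {l : Filter ι} [l.IsCountablyGenerated]
    {a b C : ℝ} (hab : a ≤ b) {w : ι → ℝ → ℝ} (hw : ∀ᶠ i in l, Continuous (w i))
    (hC : ∀ᶠ i in l, ∫ t in a..b, w i t ^ 2 ≤ C)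
    (hlim : ∀ᵐ t, Tendsto (fun i ↦ w i t) l (𝓝 0)) :
    Tendsto (fun i ↦ ∫ t in a..b, |w i t|) l (𝓝 0) := by
  have hpos : ∀ (ε : ℝ), 0 < ε → ∀ y : ℝ, 0 < 1 + ε * |y| := fun ε hε y ↦ by positivity
  -- The damped function is bounded by 1/ε, so dominated convergence applies on the finite interval.
  have key : ∀ ε : ℝ, 0 < ε →
      Tendsto (fun i ↦ ∫ t in a..b, |w i t| / (1 + ε * |w i t|)) l (𝓝 0) := by
    intro ε hε
    rw [show (0 : ℝ) = ∫ t in a..b, (0 : ℝ) by simp]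
    refine intervalIntegral.tendsto_integral_filter_of_dominated_convergence (fun _ ↦ 1 / ε)
      ?_ ?_ (by simp) ?_
    · filter_upwards [hw] with i hi
      have : Continuous fun t ↦ |w i t| / (1 + ε * |w i t|) := by
        fun_prop (disch := exact fun _ ↦ (hpos ε hε _).ne')
      exact this.aestronglyMeasurable
    · refine .of_forall fun i ↦ .of_forall fun t _ ↦ ?_
      rw [Real.norm_eq_abs, abs_of_nonneg (by positivity),
        div_le_div_iff₀ (hpos ε hε _) hε]
      linarith
    · filter_upwards [hlim] with t ht _
      have : Continuous fun y : ℝ ↦ |y| / (1 + ε * |y|) := by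
        fun_prop (disch := exact fun _ ↦ (hpos ε hε _).ne')
      simpa [Function.comp_def] using (this.tendsto 0).comp ht
  rw [Metric.tendsto_nhds]
  intro δ hδ
  set ε := δ / (2 * (|C| + 1)) with hεdef
  have hε : 0 < ε := by positivity
  filter_upwards [hw, hC, (key ε hε).eventually_lt_const (half_pos hδ)] with i hi hCi hki
  have hc2 : Continuous fun t ↦ |w i t| / (1 + ε * |w i t|) := by
    fun_prop (disch := exact fun _ ↦ (hpos ε hε _).ne')
  rw [dist_zero_right, Real.norm_eq_abs, abs_of_nonneg
    (intervalIntegral.integral_nonneg hab fun _ _ ↦ abs_nonneg _)]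
  -- The damping error is |w| - |w|/(1+ε|w|) = εw²/(1+ε|w|) ≤ εw², controlled by the L² bound.
  have h1 : ∫ t in a..b, |w i t| ≤
      ∫ t in a..b, (ε * w i t ^ 2 + |w i t| / (1 + ε * |w i t|)) := by
    refine intervalIntegral.integral_mono_on hab (Continuous.intervalIntegrable (by fun_prop) _ _)
      (Continuous.intervalIntegrable (by fun_prop) _ _) fun t _ ↦ ?_
    rw [← sub_le_iff_le_add', le_div_iff₀ (hpos ε hε _), ← sq_abs]
    have := abs_nonneg (w i t)
    nlinarith [mul_nonneg (mul_nonneg hε.le hε.le) (pow_nonneg this 3)]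
  rw [intervalIntegral.integral_add (Continuous.intervalIntegrable (by fun_prop) _ _)
    (Continuous.intervalIntegrable (by fun_prop) _ _), intervalIntegral.integral_const_mul] at h1
  have h2 : ε * ∫ t in a..b, w i t ^ 2 ≤ ε * (|C| + 1) := by
    gcongr; linarith [le_abs_self C]
  have h3 : ε * (|C| + 1) = δ / 2 := by rw [hεdef]; field_simp
  linarith

lemma re_herglotzTransform_eq_integral {f : ℝ → ℝ} (hf : Continuous f)
    (hp : Function.Periodic f (2 * Real.pi)) {w : ℂ} (hw : w ∈ Metric.ball (0 : ℂ) 1) :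
    (herglotzTransform f w).re = (2 * Real.pi)⁻¹ * ∫ θ in 0..2 * Real.pi,
      (herglotzRieszKernel 0 w (circleMap 0 1 θ)).re * f θ := by
  rw [herglotzTransform, re_circleAverage_herglotzRieszKernel_smul
    (circleIntegrable_comp_arg hf hp) hw, Real.circleAverage_def]
  simp [hp.comp_arg_circleMap one_pos]

/-- If the conjugate Poisson integral of `f` has a continuous radial limit `g` almost everywhere,
then it is the Poisson integral of `g`. -/
theorem im_herglotzTransform_eq_re_of_ae_tendsto {f g : ℝ → ℝ} (hf : Continuous f)
    (hp : Function.Periodic f (2 * Real.pi)) (hg : Continuous g)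
    (hgp : Function.Periodic g (2 * Real.pi))
    (hlim : ∀ᵐ x : ℝ, Tendsto (fun h : ℝ ↦ (herglotzTransform f (circleMap 0 (1 - h) x)).im)
      (𝓝[>] 0) (𝓝 (g x))) {w : ℂ} (hw : w ∈ Metric.ball (0 : ℂ) 1) :
    (herglotzTransform f w).im = (herglotzTransform g w).re := by
  set v : ℝ → ℝ → ℝ := fun h θ ↦ (herglotzTransform f (circleMap 0 (1 - h) θ)).im with hv
  have hIoc : Set.Ioc (0 : ℝ) 1 ∈ 𝓝[>] (0 : ℝ) := Ioc_mem_nhdsGT one_pos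
  have hvc : ∀ h ∈ Set.Ioc (0 : ℝ) 1, Continuous (v h) := fun h hh ↦
    Complex.continuous_im.comp (continuous_herglotzTransform_circleMap hf hp hh.1 hh.2)
  have hvp : ∀ h, Function.Periodic (v h) (2 * Real.pi) := fun h θ ↦ by
    simp only [hv, periodic_circleMap 0 (1 - h) θ]
  have hD := differentiableOn_herglotzTransform hf hp
  have hmul : ∀ h ∈ Set.Ioc (0 : ℝ) 1, ∀ z ∈ Metric.closedBall (0 : ℂ) 1,
      ((1 - h : ℝ) : ℂ) * z ∈ Metric.ball (0 : ℂ) 1 := by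
    intro h hh z hz
    rw [mem_closedBall_zero_iff] at hz
    rw [mem_ball_zero_iff, norm_mul, Complex.norm_real, Real.norm_eq_abs,
      abs_of_nonneg (by linarith [hh.2])]
    nlinarith [hh.1, hh.2, norm_nonneg z]
  -- the dilates of `Im H` are Poisson integrals of their boundary values
  have hdil : ∀ h ∈ Set.Ioc (0 : ℝ) 1, (herglotzTransform (v h) w).re =
      (herglotzTransform f (((1 - h : ℝ) : ℂ) * w)).im := by
    intro h hh
    refine re_herglotzTransform_eq (F := fun z ↦ herglotzTransform f (((1 - h : ℝ) : ℂ) * z)) ?_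
      Complex.imCLM (hvc h hh) (hvp h) (fun θ ↦ ?_) hw
    · apply DifferentiableOn.diffContOnCl
      rw [closure_ball _ one_ne_zero]
      exact hD.comp (by fun_prop) (hmul h hh)
    · simp [hv, circleMap_zero]
  have hL : Tendsto (fun h : ℝ ↦ (herglotzTransform (v h) w).re) (𝓝[>] 0)
      (𝓝 (herglotzTransform f w).im) := by
    have h1 : ContinuousAt (herglotzTransform f) w :=
      (hD.differentiableAt (Metric.isOpen_ball.mem_nhds hw)).continuousAt
    have h2 : Tendsto (fun h : ℝ ↦ ((1 - h : ℝ) : ℂ) * w) (𝓝[>] 0) (𝓝 w) := by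
      have : Continuous fun h : ℝ ↦ ((1 - h : ℝ) : ℂ) * w := by fun_prop
      simpa using (this.tendsto 0).mono_left nhdsWithin_le_nhds
    refine ((Complex.continuous_im.tendsto _).comp (h1.tendsto.comp h2)).congr' ?_
    filter_upwards [hIoc] with h hh using (hdil h hh).symm
  obtain ⟨C, hC⟩ := exists_integral_im_herglotzTransform_sq_le hf hp
  have hI : Tendsto (fun h ↦ ∫ t in 0..2 * Real.pi, |v h t - g t|) (𝓝[>] 0) (𝓝 0) := by
    refine tendsto_integral_abs_zero_of_sq_bound (by positivity)
      (C := 2 * C + 2 * ∫ t in 0..2 * Real.pi, g t ^ 2) ?_ ?_ ?_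
    · filter_upwards [hIoc] with h hh using (hvc h hh).sub hg
    · filter_upwards [hIoc, hC] with h hh hCh
      have hc := hvc h hh
      calc ∫ t in 0..2 * Real.pi, (v h t - g t) ^ 2
          ≤ ∫ t in 0..2 * Real.pi, (2 * v h t ^ 2 + 2 * g t ^ 2) := by
            refine intervalIntegral.integral_mono_on (by positivity)
              (Continuous.intervalIntegrable (by fun_prop) _ _)
              (Continuous.intervalIntegrable (by fun_prop) _ _) fun t _ ↦ ?_
            nlinarith [sq_nonneg (v h t + g t)]
        _ = 2 * (∫ t in 0..2 * Real.pi, v h t ^ 2) + 2 * ∫ t in 0..2 * Real.pi, g t ^ 2 := by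
            rw [intervalIntegral.integral_add (Continuous.intervalIntegrable (by fun_prop) _ _)
              (Continuous.intervalIntegrable (by fun_prop) _ _),
              intervalIntegral.integral_const_mul, intervalIntegral.integral_const_mul]
        _ ≤ _ := by linarith
    · filter_upwards [hlim] with t ht
      simpa using ht.sub_const (g t)
  set k : ℝ → ℝ := fun θ ↦ (herglotzRieszKernel 0 w (circleMap 0 1 θ)).re with hk
  have hkc : Continuous k := by
    refine Complex.continuous_re.comp
      ((continuousOn_herglotzRieszKernel_sphere hw).comp_continuous (continuous_circleMap 0 1) ?_)
    intro θ; exact circleMap_mem_sphere' 0 1 θ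
  have hkp : Function.Periodic k (2 * Real.pi) := fun θ ↦ by
    simp only [hk, periodic_circleMap 0 1 θ]
  obtain ⟨B, hB⟩ := (hkp.isBounded_of_continuous (by positivity) hkc).exists_norm_le
  -- For fixed w the Poisson kernel is bounded on the circle, so L¹ convergence of boundary values
  -- suffices.
  have hR : Tendsto (fun h : ℝ ↦ (herglotzTransform (v h) w).re) (𝓝[>] 0)
      (𝓝 (herglotzTransform g w).re) := by
    rw [tendsto_iff_norm_sub_tendsto_zero]
    refine squeeze_zero' (.of_forall fun _ ↦ norm_nonneg _) ?_
      (g := fun h ↦ (2 * Real.pi)⁻¹ * (B * ∫ t in 0..2 * Real.pi, |v h t - g t|))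
      (by simpa using (hI.const_mul B).const_mul (2 * Real.pi)⁻¹)
    filter_upwards [hIoc] with h hh
    have hc := hvc h hh
    rw [re_herglotzTransform_eq_integral hc (hvp h) hw, re_herglotzTransform_eq_integral hg hgp hw]
    change ‖_ * (∫ θ in 0..2 * Real.pi, k θ * v h θ) - _ * ∫ θ in 0..2 * Real.pi, k θ * g θ‖ ≤ _
    rw [← mul_sub, ← intervalIntegral.integral_sub
      (Continuous.intervalIntegrable (by fun_prop) _ _)
      (Continuous.intervalIntegrable (by fun_prop) _ _), norm_mul, Real.norm_of_nonneg (r := _⁻¹)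
      (by positivity), ← intervalIntegral.integral_const_mul]
    gcongr
    refine intervalIntegral.norm_integral_le_of_norm_le (by positivity) (.of_forall fun t _ ↦ ?_)
      (Continuous.intervalIntegrable (by fun_prop) _ _)
    rw [← mul_sub, norm_mul]
    exact mul_le_mul_of_nonneg_right (hB _ ⟨t, rfl⟩) (norm_nonneg _)
  exact tendsto_nhds_unique hL hR

/-! ### Zamansky's theorem -/

theorem tendstoUniformly_im_herglotzTransform_iff {f g : ℝ → ℝ} (hf : Continuous f)
    (hp : Function.Periodic f (2 * Real.pi)) :
    TendstoUniformly (fun h x : ℝ ↦ (herglotzTransform f (circleMap 0 (1 - h) x)).im) g (𝓝[>] 0) ↔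
      TendstoUniformly (fun h x : ℝ ↦ truncatedConjugate f h x) g (𝓝[>] 0) := by
  have h0 := tendstoUniformly_im_herglotzTransform_sub hf hp
  constructor
  · intro h
    simpa [Pi.sub_def] using h.sub h0
  · intro h
    simpa [Pi.add_def] using h.add h0

lemma Function.Periodic.truncatedConjugate {𝕜 : Type*} [RCLike 𝕜] {f : ℝ → 𝕜}
    (hp : Function.Periodic f (2 * Real.pi)) (h : ℝ) :
    Function.Periodic (truncatedConjugate f h) (2 * Real.pi) := by
  intro x
  simp only [_root_.truncatedConjugate]
  congr 2
  ext t
  rw [← hp (x + t), ← hp (x - t)]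
  ring_nf

theorem tendstoUniformly_truncatedConjugate_of_isConjugateFunction {f g : ℝ → ℝ}
    (hf : Continuous f) (hp : Function.Periodic f (2 * Real.pi)) (hg : Continuous g)
    (hfg : IsConjugateFunction f g) :
    TendstoUniformly (fun h x : ℝ ↦ truncatedConjugate f h x) g (𝓝[>] 0) := by
  -- The a.e. limit inherits periodicity almost everywhere; continuity of `g` makes it hold
  -- everywhere.
  have hgp : Function.Periodic g (2 * Real.pi) := by
    have h1 : (fun x ↦ g (x + 2 * Real.pi)) =ᵐ[volume] g := by
      have h2 : ∀ᵐ x : ℝ, Tendsto (fun h : ℝ ↦ truncatedConjugate f h (x + 2 * Real.pi)) (𝓝[>] 0)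
          (𝓝 (g (x + 2 * Real.pi))) :=
        (measurePreserving_add_right volume (2 * Real.pi)).quasiMeasurePreserving.ae hfg
      filter_upwards [hfg, h2] with x hx hx'
      simp only [hp.truncatedConjugate _ x] at hx'
      exact tendsto_nhds_unique hx' hx
    exact congrFun (Continuous.ae_eq_iff_eq volume (by fun_prop) hg |>.1 h1)
  have h0 := tendstoUniformly_im_herglotzTransform_sub hf hp
  have hlim : ∀ᵐ x : ℝ, Tendsto (fun h : ℝ ↦ (herglotzTransform f (circleMap 0 (1 - h) x)).im)
      (𝓝[>] 0) (𝓝 (g x)) := by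
    filter_upwards [hfg] with x hx
    simpa using (h0.tendsto_at x).add hx
  rw [← tendstoUniformly_im_herglotzTransform_iff hf hp]
  rw [Metric.tendstoUniformly_iff]
  intro ε hε
  filter_upwards [Metric.tendstoUniformly_iff.1 (tendstoUniformly_re_herglotzTransform hg hgp) ε hε,
    Ioc_mem_nhdsGT (show (0 : ℝ) < 1 by norm_num)] with h hε' hh x
  rw [im_herglotzTransform_eq_re_of_ae_tendsto hf hp hg hgp hlim
    (circleMap_one_sub_mem_ball hh.1 hh.2 x)]
  exact hε' x

lemma continuous_truncatedConjugate {𝕜 : Type*} [RCLike 𝕜] {f : ℝ → 𝕜} (hf : Continuous f)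
    (hp : Function.Periodic f (2 * Real.pi)) {h : ℝ} (h0 : 0 < h) (hh : h ≤ Real.pi) :
    Continuous (truncatedConjugate f h) := by
  obtain ⟨B, hB⟩ := (hp.isBounded_of_continuous (by positivity) hf).exists_norm_le
  have hB' : ∀ x, ‖f x‖ ≤ B := fun x ↦ hB _ ⟨x, rfl⟩
  refine (intervalIntegral.continuous_of_dominated_interval
    (bound := fun t ↦ ‖((1 / 2 : ℝ) * Real.cot (t / 2)) • (2 * B)‖)
    (fun x ↦ ?_) (fun x ↦ .of_forall fun t _ ↦ ?_) ?_ ?_).const_smul _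
  · exact (intervalIntegrable_cot_smul (φ := fun t ↦ f (x + t) - f (x - t)) (by fun_prop) h0
      hh).aestronglyMeasurable_restrict_uIoc
  · rw [norm_smul, norm_smul]
    gcongr
    refine (norm_sub_le _ _).trans (le_trans ?_ (le_abs_self _))
    linarith [hB' (x + t), hB' (x - t)]
  · exact (intervalIntegrable_cot_smul (φ := fun _ ↦ 2 * B) continuous_const h0 hh).norm
  · exact .of_forall fun t _ ↦ by fun_prop

lemma continuous_of_tendstoUniformly_truncatedConjugate {𝕜 : Type*} [RCLike 𝕜] {f g : ℝ → 𝕜}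
    (hf : Continuous f) (hp : Function.Periodic f (2 * Real.pi))
    (hfg : TendstoUniformly (fun h x : ℝ ↦ truncatedConjugate f h x) g (𝓝[>] 0)) :
    Continuous g := by
  refine hfg.continuous (Eventually.frequently ?_)
  filter_upwards [Ioc_mem_nhdsGT Real.pi_pos] with h hh
  exact continuous_truncatedConjugate hf hp hh.1 hh.2

lemma ContinuousLinearMap.truncatedConjugate_comp {𝕜 : Type*} [RCLike 𝕜] (T : 𝕜 →L[ℝ] ℝ)
    {f : ℝ → 𝕜} (hf : Continuous f) {h : ℝ} (h0 : 0 < h) (hh : h ≤ Real.pi) (x : ℝ) :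
    truncatedConjugate (fun x ↦ T (f x)) h x = T (truncatedConjugate f h x) := by
  simp only [truncatedConjugate]
  rw [map_smul, ← T.intervalIntegral_comp_comm
    (intervalIntegrable_cot_smul (φ := fun t ↦ f (x + t) - f (x - t)) (by fun_prop) h0 hh)]
  simp only [map_smul, map_sub]

lemma IsConjugateFunction.comp {𝕜 : Type*} [RCLike 𝕜] (T : 𝕜 →L[ℝ] ℝ) {f g : ℝ → 𝕜}
    (hf : Continuous f) (hfg : IsConjugateFunction f g) :
    IsConjugateFunction (fun x ↦ T (f x)) (fun x ↦ T (g x)) := by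
  filter_upwards [hfg] with x hx
  refine ((T.continuous.tendsto _).comp hx).congr' ?_
  filter_upwards [Ioc_mem_nhdsGT Real.pi_pos] with h hh
  exact (T.truncatedConjugate_comp hf hh.1 hh.2 x).symm

/-- **Zamansky's theorem**. -/
theorem hasContinuousConjugate_iff {𝕜 : Type*} [RCLike 𝕜] {f : ℝ → 𝕜} (hf : Continuous f)
    (hp : Function.Periodic f (2 * Real.pi)) :
    HasContinuousConjugate f ↔ TruncatedConjugateConvergesUniformly f := by
  constructor
  · rintro ⟨g, hg, hfg⟩
    have key : ∀ T : 𝕜 →L[ℝ] ℝ, TendstoUniformly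
        (fun h x : ℝ ↦ truncatedConjugate (fun x ↦ T (f x)) h x) (fun x ↦ T (g x)) (𝓝[>] 0) :=
      fun T ↦ tendstoUniformly_truncatedConjugate_of_isConjugateFunction (T.continuous.comp hf)
        (fun x ↦ congrArg T (hp x)) (T.continuous.comp hg) (hfg.comp T hf)
    refine ⟨g, Metric.tendstoUniformly_iff.2 fun ε hε ↦ ?_⟩
    filter_upwards [Metric.tendstoUniformly_iff.1 (key RCLike.reCLM) _ (half_pos hε),
      Metric.tendstoUniformly_iff.1 (key RCLike.imCLM) _ (half_pos hε),
      Ioc_mem_nhdsGT Real.pi_pos] with h hre him hh x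
    have h1 := hre x
    have h2 := him x
    rw [ContinuousLinearMap.truncatedConjugate_comp _ hf hh.1 hh.2, Real.dist_eq, ← map_sub] at h1 h2
    simp only [RCLike.reCLM_apply, RCLike.imCLM_apply] at h1 h2
    rw [dist_eq_norm]
    set z := g x - truncatedConjugate f h x
    calc ‖z‖ = ‖((RCLike.re z : ℝ) : 𝕜) + ((RCLike.im z : ℝ) : 𝕜) * RCLike.I‖ := by
          rw [RCLike.re_add_im]
      _ ≤ |RCLike.re z| + |RCLike.im z| * 1 := by
          refine (norm_add_le _ _).trans ?_
          rw [norm_mul, RCLike.norm_ofReal, RCLike.norm_ofReal]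
          gcongr
          rw [RCLike.norm_I]; split_ifs <;> norm_num
      _ < ε := by linarith
  · rintro ⟨g, hg⟩
    exact ⟨g, continuous_of_tendstoUniformly_truncatedConjugate hf hp hg,
      .of_forall fun x ↦ hg.tendsto_at x⟩

/-! ### The disc algebra -/

/-- The jump of `arg` across the negative axis is a period, so it disappears modulo 2π. -/
lemma Function.Periodic.continuousAt_comp_arg {E : Type*} [TopologicalSpace E] {f : ℝ → E}
    (hf : Continuous f) (hp : Function.Periodic f (2 * Real.pi)) {z : ℂ} (hz : z ≠ 0) :
    ContinuousAt (fun ζ : ℂ ↦ f ζ.arg) z := by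
  have h1 : Continuous (hp.lift : Real.Angle → E) := hf.quotient_lift _
  exact h1.continuousAt.comp (Complex.continuousAt_arg_coe_angle hz)

/-- A function on the open disc that converges uniformly along radii to a continuous function
extends continuously to the closed disc. -/
lemma continuousOn_closedBall_of_tendstoUniformly {H : ℂ → ℂ} {b : ℝ → ℂ}
    (hH : ContinuousOn H (Metric.ball 0 1)) (hb : Continuous b)
    (hbp : Function.Periodic b (2 * Real.pi))
    (hlim : TendstoUniformly (fun h x : ℝ ↦ H (circleMap 0 (1 - h) x)) b (𝓝[>] 0)) :
    ContinuousOn (fun z ↦ if ‖z‖ < 1 then H z else b z.arg) (Metric.closedBall 0 1) := by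
  intro z hz
  rw [mem_closedBall_zero_iff] at hz
  apply ContinuousAt.continuousWithinAt
  rcases hz.lt_or_eq with hz1 | hz1
  · have hzb : z ∈ Metric.ball (0 : ℂ) 1 := by simpa using hz1
    refine (hH.continuousAt (Metric.isOpen_ball.mem_nhds hzb)).congr ?_
    filter_upwards [Metric.isOpen_ball.mem_nhds hzb] with ζ hζ
    rw [if_pos (by simpa using hζ)]
  · have hz0 : z ≠ 0 := by rintro rfl; simp at hz1
    have hB := hbp.continuousAt_comp_arg hb hz0
    rw [Metric.continuousAt_iff'] at hB ⊢
    intro ε hε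
    obtain ⟨δ, hδ, hδ'⟩ := mem_nhdsGT_iff_exists_Ioo_subset.1
      (Metric.tendstoUniformly_iff.1 hlim _ (half_pos hε))
    have hn : ∀ᶠ ζ : ℂ in 𝓝 z, 1 - δ < ‖ζ‖ := by
      refine continuous_norm.continuousAt.eventually_const_lt ?_
      linarith [Set.mem_Ioi.1 hδ]
    filter_upwards [hB _ (half_pos hε), hn] with ζ h1 h2
    rw [if_neg (c := ‖z‖ < 1) hz1.not_lt]
    by_cases hζ : ‖ζ‖ < 1
    · rw [if_pos hζ]
      -- Uniformity in the angle matters: ζ is compared with the boundary point on its own ray, at h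
      -- = 1 - ‖ζ‖.
      have h3 : dist (b ζ.arg) (H (circleMap 0 (1 - (1 - ‖ζ‖)) ζ.arg)) < ε / 2 :=
        hδ' (show 1 - ‖ζ‖ ∈ Set.Ioo 0 δ from ⟨by linarith, by linarith⟩) ζ.arg
      rw [sub_sub_cancel, circleMap_zero, Complex.norm_mul_exp_arg_mul_I] at h3
      have := dist_triangle_left (H ζ) (b z.arg) (b ζ.arg)
      linarith
    · rw [if_neg hζ]; linarith

/-- **Solution of von Renteln's problem**: characterization of the real parts of functions of the
disc algebra. -/
theorem exists_inDiscAlgebra_re_eq_iff {u : Circle → ℝ} (hu : Continuous u) :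
    (∃ F : ℂ → ℂ, InDiscAlgebra F ∧ ∀ z : Circle, (F (z : ℂ)).re = u z) ↔
      TruncatedConjugateConvergesUniformly (fun x : ℝ ↦ u (Circle.exp x)) := by
  set f : ℝ → ℝ := fun x ↦ u (Circle.exp x) with hfdef
  have hf : Continuous f := hu.comp Circle.exp.continuous
  have hp : Function.Periodic f (2 * Real.pi) := fun x ↦ by
    simp only [hfdef, Circle.periodic_exp x]
  constructor
  · rintro ⟨F, ⟨hFc, hFd⟩, hFu⟩
    have hF : DiffContOnCl ℂ F (Metric.ball 0 1) :=
      ⟨hFd, by rwa [closure_ball _ one_ne_zero]⟩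
    have hre : ∀ w ∈ Metric.ball (0 : ℂ) 1, (herglotzTransform f w).re = (F w).re := by
      intro w hw
      refine re_herglotzTransform_eq hF Complex.reCLM hf hp (fun θ ↦ ?_) hw
      rw [hfdef, Complex.reCLM_apply]
      simp only [← hFu, Circle.coe_exp, circleMap_zero, Complex.ofReal_one, one_mul]
    have han : AnalyticOnNhd ℂ (fun w ↦ herglotzTransform f w - F w) (Metric.ball 0 1) :=
      ((differentiableOn_herglotzTransform hf hp).sub hFd).analyticOnNhd Metric.isOpen_ball
    -- H - F has zero real part, hence is constant; this shifts the limit of Im H by Im c.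
    obtain ⟨c, hc⟩ := han.eq_const_of_re_eq_const (c₀ := 0)
      (fun w hw ↦ by rw [Complex.sub_re, hre w hw, sub_self]) Metric.isOpen_ball
      (Metric.isConnected_ball one_pos)
    refine ⟨fun x ↦ (F (circleMap 0 1 x)).im + c.im,
      (tendstoUniformly_im_herglotzTransform_iff hf hp).1 ?_⟩
    have huc := (isCompact_closedBall (0 : ℂ) 1).uniformContinuousOn_of_continuous hFc
    rw [Metric.tendstoUniformly_iff]
    intro ε hε
    obtain ⟨δ, hδ, H⟩ := Metric.uniformContinuousOn_iff.1 huc ε hε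
    filter_upwards [Ioc_mem_nhdsGT one_pos, Ioo_mem_nhdsGT hδ] with h hh hhδ x
    have hw := circleMap_one_sub_mem_ball hh.1 hh.2 x
    have h1 : herglotzTransform f (circleMap 0 (1 - h) x) = F (circleMap 0 (1 - h) x) + c :=
      sub_eq_iff_eq_add'.1 (hc _ hw)
    have h2 := H (circleMap 0 1 x) (by simp) _ (Metric.ball_subset_closedBall hw) (by
      rw [dist_eq_norm, circleMap_zero, circleMap_zero, ← sub_mul, norm_mul,
        Complex.norm_exp_ofReal_mul_I, mul_one, ← Complex.ofReal_sub, sub_sub_cancel,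
        Complex.norm_real, Real.norm_eq_abs, abs_of_pos hh.1]
      exact hhδ.2)
    rw [h1, Complex.add_im, dist_add_right, Real.dist_eq, ← Complex.sub_im]
    rw [dist_eq_norm] at h2
    exact (Complex.abs_im_le_norm _).trans_lt h2
  · rintro ⟨g, hg⟩
    have hgc := continuous_of_tendstoUniformly_truncatedConjugate hf hp hg
    have hgp : Function.Periodic g (2 * Real.pi) := fun x ↦ by
      have h1 := hg.tendsto_at (x + 2 * Real.pi)
      simp only [hp.truncatedConjugate _ x] at h1
      exact tendsto_nhds_unique h1 (hg.tendsto_at x)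
    have him := (tendstoUniformly_im_herglotzTransform_iff hf hp).2 hg
    have hre := tendstoUniformly_re_herglotzTransform hf hp
    set b : ℝ → ℂ := fun x ↦ (f x : ℂ) + (g x : ℂ) * Complex.I with hb
    have hlim : TendstoUniformly
        (fun h x : ℝ ↦ herglotzTransform f (circleMap 0 (1 - h) x)) b (𝓝[>] 0) := by
      rw [Metric.tendstoUniformly_iff] at him hre ⊢
      intro ε hε
      filter_upwards [him _ (half_pos hε), hre _ (half_pos hε)] with h h1 h2 x
      have h3 := h1 x
      have h4 := h2 x
      rw [Real.dist_eq] at h3 h4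
      rw [dist_eq_norm]
      refine (Complex.norm_le_abs_re_add_abs_im _).trans_lt ?_
      simp only [hb, Complex.sub_re, Complex.sub_im, Complex.add_re, Complex.add_im,
        Complex.ofReal_re, Complex.ofReal_im, Complex.re_ofReal_mul, Complex.im_ofReal_mul,
        Complex.I_re, Complex.I_im, mul_zero, mul_one, add_zero, zero_add]
      linarith
    have hd := differentiableOn_herglotzTransform hf hp
    -- Unification supplies the function equal to H inside the disc and to f + ig, evaluated at the
    -- argument, elsewhere.
    refine ⟨_, ⟨continuousOn_closedBall_of_tendstoUniformly hd.continuousOn (by fun_prop)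
      (fun x ↦ by simp only [hb, hp x, hgp x]) hlim, hd.congr fun z hz ↦ ?_⟩, fun z ↦ ?_⟩
    · rw [if_pos (by simpa using hz)]
    · rw [if_neg (Circle.norm_coe z).not_lt]
      simp [hb, hfdef]

theorem mainTheorem1 {𝕜 : Type*} [RCLike 𝕜] :
    (∀ f : ℝ → 𝕜, Continuous f → Function.Periodic f (2 * Real.pi) →
      (HasContinuousConjugate f ↔ TruncatedConjugateConvergesUniformly f)) ∧
    (∀ u : Circle → ℝ, Continuous u →
      ((∃ F : ℂ → ℂ, InDiscAlgebra F ∧ ∀ z : Circle, (F (z : ℂ)).re = u z) ↔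
        TruncatedConjugateConvergesUniformly (fun x : ℝ => u (Circle.exp x)))) :=
  ⟨fun _ hf hp ↦ hasContinuousConjugate_iff hf hp, fun _ hu ↦ exists_inDiscAlgebra_re_eq_iff hu⟩
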